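/- Let $g:[0,1]\to[0,1]$ be a distortion function (non-decreasing, $g(0)=0$, $g(1)=1$) that is concave and absolutely continuous, with weight function $\gamma(u)=\partial_- g(x)|_{x=1-u}$, $0<u<1$ (left derivative), such that $\int_0^1\gamma(u)^2\,du<\infty$ and $\gamma\not\equiv 1$ on $(0,1)$. For a distribution function $G$ on $\mathbb R$ with finite second moment let $$H_g(G)=-\int_{-\infty}^0\bigl(1-g(1-G(y))\bigr)\,dy+\int_0^\infty g(1-G(y))\,dy,$$ let $G^{-1}(u)=\inf\{y: G(y)\ge u\}$ be its quantile function, and let $d_W(G_1,G_2)=\inf\{\mathbb E[(X_1-X_2)^2]^{1/2}: X_1\sim G_1,\ X_2\sim G_2\}$ (infimum over all couplings) be the Wasserstein distance of order 2. Let $\mathcal P\subseteq\mathbb R^n$ be a set of portfolios (for instance a polyhedral one), $\boldsymbol\mu\in\mathbb R^n$, and let $\Sigma$ be a real symmetric positive semidefinite $n\times n$ matrix. Put $\mu_x=x^\top\boldsymbol\mu$ and $\sigma_x=\sqrt{x^\top\Sigma x}$, and assume $\sigma_x>0$ for all $x\in\mathcal P$. Let $F$ be a distribution function with mean $0$ and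 variance $1$, and let $F_x$ be the benchmark distribution with quantile function $F_x^{-1}(u)=-\mu_x+\sigma_x F^{-1}(u)$, $0<u<1$. Let $\mathcal M(\boldsymbol\mu,\Sigma)$ be the set of all distributions on $\mathbb R^n$ with mean vector $\boldsymbol\mu$ and covariance matrix $\Sigma$; for $G_R\in\mathcal M(\boldsymbol\mu,\Sigma)$ let $G_x$ be the distribution of the loss $-x^\top R$, where $R\sim G_R$. Finally, for every $x\in\mathcal P$ let a tolerance $\varepsilon_x\in[0,+\infty]$ be given. Let $U$ be uniform on $(0,1)$, $V=\operatorname{var}(\gamma(U))$, $c_0=\operatorname{corr}(F^{-1}(U),\gamma(U))$, and $\underline{\varepsilon_x}=\min\{\varepsilon_x,\,2\sigma_x^2(1-c_0)\}$. Then for every $x\in\mathcal P$ $$\max_{\substack{G_R\in\mathcal M(\boldsymbol\mu,\Sigma)\\ d_W(F_x,G_x)\le\sqrt{\varepsilon_x}}}H_g(G_x) =-\mu_x+\Bigl(\sigma_x-\frac{\underline{\varepsilon_x}}{2\sigma_x}\Bigr)\sqrt V\,c_0+\sqrt{\underline{\varepsilon_x}-\frac{\underline{\varepsilon_x}^2}{4\sigma_x^2}}\;\sqrt{V(1-c_0^2)},$$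 and the maximum is attained. Consequently the robust portfolio problem $$\min_{x\in\mathcal P}\ \max_{\substack{G_R\in\mathcal M(\boldsymbol\mu,\Sigma)\\ d_W(F_x,G_x)\le\sqrt{\varepsilon_x}}}H_g(G_x)$$ is equivalent to minimising the right-hand side over $x\in\mathcal P$: the two problems have the same optimal value (infimum) and the same minimisers. -/

import Mathlib

open MeasureTheory ProbabilityTheory Set
open scoped ENNReal Matrix

noncomputable section

namespace RobustPortfolio

/-! ## Distributions on the real line

A distribution function is represented by the Borel probability measure on `ℝ` it belongs to;
`ProbabilityTheory.cdf` recovers the distribution function. -/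

/-- The left-continuous inverse (quantile function) of the distribution function of `G`, to be
read for `0 < u < 1`. -/
def quantile (G : Measure ℝ) (u : ℝ) : ℝ := sInf {y : ℝ | u ≤ cdf G y}

/-- The law of a standard uniform random variable `U` on `(0, 1)`. -/
def unif : Measure ℝ := volume.restrict (Ioo (0 : ℝ) 1)

/-- Pearson correlation of `X` and `Y` under `P`. -/
def corr {Ω : Type*} [MeasurableSpace Ω] (X Y : Ω → ℝ) (P : Measure Ω) : ℝ :=
  covariance X Y P / (√(variance X P) * √(variance Y P))

/-- The couplings of `G₁` and `G₂`: the bivariate laws with marginals `G₁` and `G₂`. -/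
def couplings (G₁ G₂ : Measure ℝ) : Set (Measure (ℝ × ℝ)) :=
  {π | π.map Prod.fst = G₁ ∧ π.map Prod.snd = G₂}

/-- The Wasserstein distance of order 2, as the infimum over couplings of `E[(X₁ - X₂)²]^{1/2}`. -/
def wasserstein (G₁ G₂ : Measure ℝ) : ℝ≥0∞ :=
  ⨅ π ∈ couplings G₁ G₂, (∫⁻ p, ENNReal.ofReal ((p.1 - p.2) ^ 2) ∂π) ^ (1 / 2 : ℝ)

/-! ## Distortion risk measures -/

/-- Distortion functions on `[0, 1]` (values outside `[0, 1]` are irrelevant). Monotonicity and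
the boundary values give `g '' [0, 1] ⊆ [0, 1]`. -/
structure IsDistortion (g : ℝ → ℝ) : Prop where
  monotoneOn : MonotoneOn g (Icc 0 1)
  zero : g 0 = 0
  one : g 1 = 1

/-- The distortion risk measure `H_g(G)` as the Choquet integral
`- ∫_{-∞}^0 (1 - g (1 - G x)) dx + ∫_0^∞ g (1 - G x) dx`. Both integrands are nonnegative, so the
two integrals are taken in `[0, ∞]` and the difference in the extended reals. -/
def distortionRisk (g : ℝ → ℝ) (G : Measure ℝ) : EReal :=
  ((∫⁻ x in Ioi (0 : ℝ), ENNReal.ofReal (g (1 - cdf G x)) : ℝ≥0∞) : EReal)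
    - ((∫⁻ x in Iio (0 : ℝ), ENNReal.ofReal (1 - g (1 - cdf G x)) : ℝ≥0∞) : EReal)

/-- The weight function `γ(u) = ∂₋ g(x)|_{x = 1 - u}`, `0 < u < 1`, with the left derivative. -/
def weight (g : ℝ → ℝ) (u : ℝ) : ℝ := derivWithin g (Iio (1 - u)) (1 - u)

/-- `V = var(γ(U))`. -/
def weightVar (g : ℝ → ℝ) : ℝ := variance (weight g) unif

/-- `c₀ = corr(F⁻¹(U), γ(U))`. -/
def c0 (g : ℝ → ℝ) (F : Measure ℝ) : ℝ := corr (quantile F) (weight g) unif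

/-! ## Portfolios -/

variable {n : ℕ}

/-- `𝓜(m, Σ)`: laws of random return vectors with square integrable coordinates, mean vector `m`
and covariance matrix `S`. -/
structure HasMoments (R : Measure (Fin n → ℝ)) (m : Fin n → ℝ) (S : Matrix (Fin n) (Fin n) ℝ) :
    Prop where
  isProbabilityMeasure : IsProbabilityMeasure R
  memLp : ∀ i, MemLp (fun r : Fin n → ℝ => r i) 2 R
  mean : ∀ i, ∫ r : Fin n → ℝ, (r i) ∂(R) = m i
  cov : ∀ i j, covariance (fun r : Fin n → ℝ => r i) (fun r : Fin n → ℝ => r j) R = S i j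

/-- `μ_x = xᵀ m`. -/
def portMean (m x : Fin n → ℝ) : ℝ := x ⬝ᵥ m

/-- `σ_x`, the nonnegative root of `σ_x² = xᵀ S x`. -/
def portStd (S : Matrix (Fin n) (Fin n) ℝ) (x : Fin n → ℝ) : ℝ := √(x ⬝ᵥ (S *ᵥ x))

/-- `G_x`, the law of the aggregate loss `- xᵀ R` when the return vector has law `R`. -/
def lossLaw (R : Measure (Fin n → ℝ)) (x : Fin n → ℝ) : Measure ℝ := R.map fun r => -(x ⬝ᵥ r)

/-- The law of `a + b Z` with `Z ∼ F`. -/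
def locScale (F : Measure ℝ) (a b : ℝ) : Measure ℝ := F.map fun z => a + b * z

/-- For `b > 0`, `locScale F a b` is the member of the location-scale family of `F` that has
quantile function `a + b F⁻¹`. -/
theorem quantile_locScale (F : Measure ℝ) [IsProbabilityMeasure F] (a : ℝ) {b : ℝ} (hb : 0 < b)
    {u : ℝ} (hu : u ∈ Ioo (0 : ℝ) 1) :
    quantile (locScale F a b) u = a + b * quantile F u := by
  have hm : Measurable fun z : ℝ => a + b * z := by fun_prop
  have : IsProbabilityMeasure (locScale F a b) := Measure.isProbabilityMeasure_map hm.aemeasurable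
  have hcdf : ∀ z, cdf (locScale F a b) (a + b * z) = cdf F z := by
    intro z
    rw [cdf_eq_real, cdf_eq_real, locScale, map_measureReal_apply hm measurableSet_Iic]
    congr 1
    ext w
    simp [hb]
  have hset : {y : ℝ | u ≤ cdf (locScale F a b) y}
      = (fun z => a + b * z) '' {y : ℝ | u ≤ cdf F y} := by
    ext y
    constructor
    · intro hy
      have hyz : a + b * ((y - a) / b) = y := by field_simp; ring
      refine ⟨(y - a) / b, ?_, hyz⟩
      rw [mem_ofPred_eq, ← hcdf, hyz]
      exact hy
    · rintro ⟨z, hz, rfl⟩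
      simpa [hcdf] using hz
  have hne : {y : ℝ | u ≤ cdf F y}.Nonempty :=
    ((tendsto_cdf_atTop F).eventually (eventually_ge_nhds hu.2)).exists
  have hbdd : BddBelow {y : ℝ | u ≤ cdf F y} := by
    obtain ⟨y₀, hy₀⟩ := ((tendsto_cdf_atBot F).eventually (eventually_lt_nhds hu.1)).exists
    refine ⟨y₀, fun y hy => ?_⟩
    by_contra! h
    exact absurd (hy.trans (monotone_cdf F h.le)) (not_le.2 hy₀)
  have hmono : Monotone fun z : ℝ => a + b * z := fun p q hpq => by
    have := mul_le_mul_of_nonneg_left hpq hb.le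
    simpa using this
  rw [quantile, quantile, hset]
  exact (hmono.map_csInf_of_continuousAt (by fun_prop) hne hbdd).symm

/-- `F_x`, the benchmark law of the loss, with `F_x⁻¹ = - μ_x + σ_x F⁻¹`. -/
def benchmark (F : Measure ℝ) (m : Fin n → ℝ) (S : Matrix (Fin n) (Fin n) ℝ) (x : Fin n → ℝ) :
    Measure ℝ := locScale F (-portMean m x) (portStd S x)

/-- The values of the inner maximisation problem at the portfolio `x` with tolerance `ε`:
`H_g(G_x)` over all laws `R ∈ 𝓜(m, S)` of the returns with `d_W(F_x, G_x) ≤ √ε`. -/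
def riskValues (g : ℝ → ℝ) (F : Measure ℝ) (m : Fin n → ℝ) (S : Matrix (Fin n) (Fin n) ℝ)
    (ε : ℝ≥0∞) (x : Fin n → ℝ) : Set EReal :=
  {h | ∃ R : Measure (Fin n → ℝ), HasMoments R m S ∧
    wasserstein (benchmark F m S x) (lossLaw R x) ≤ ε ^ (1 / 2 : ℝ) ∧
    h = distortionRisk g (lossLaw R x)}

/-- The worst-case risk of the portfolio `x`. -/
def worstCaseRisk (g : ℝ → ℝ) (F : Measure ℝ) (m : Fin n → ℝ) (S : Matrix (Fin n) (Fin n) ℝ)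
    (ε : ℝ≥0∞) (x : Fin n → ℝ) : EReal := sSup (riskValues g F m S ε x)

/-- `min {ε, 2 σ_x² (1 - c₀)}`; it is finite also for `ε = ∞`. -/
def effTol (g : ℝ → ℝ) (F : Measure ℝ) (S : Matrix (Fin n) (Fin n) ℝ) (ε : ℝ≥0∞)
    (x : Fin n → ℝ) : ℝ :=
  (min ε (ENNReal.ofReal (2 * portStd S x ^ 2 * (1 - c0 g F)))).toReal

/-- The explicit objective function. -/
def objective (g : ℝ → ℝ) (F : Measure ℝ) (m : Fin n → ℝ) (S : Matrix (Fin n) (Fin n) ℝ)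
    (ε : ℝ≥0∞) (x : Fin n → ℝ) : ℝ :=
  -portMean m x
    + (portStd S x - effTol g F S ε x / (2 * portStd S x)) * (√(weightVar g) * c0 g F)
    + √(effTol g F S ε x - effTol g F S ε x ^ 2 / (4 * portStd S x ^ 2))
      * √(weightVar g * (1 - c0 g F ^ 2))

end RobustPortfolio

end

namespace RobustPortfolio

/-! ## Monotone functions of a uniform variable -/

/-! Everything reduces to the geometry of three vectors in L² of the uniform law: the quantile
function X of the loss, the benchmark quantile Y = F⁻¹ and the weight Z = γ. Since γ has mean 1, the
risk is E[γX] = -μ_x + cov(X, Z) (`distortionRisk_map_unif`, `integral_weight_mul`). The comonotone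
coupling is optimal for the quadratic cost (`lintegral_sq_sub_le_of_coupling`), and X has mean and
variance matching the benchmark, so the squared distance is 2σ²(1 - corr(X, Y)). The Wasserstein
ball is therefore the constraint corr(X, Y) ≥ r, where the effective tolerance is 2σ²(1 - r) and r ≥
c₀; when the cap is active, r = c₀ and no constraint is needed.

After normalisation, Y and Z enclose the angle arccos c₀, and X lies within arccos r of Y. Hence X
and Z enclose at least arccos c₀ - arccos r, which bounds the correlation by r c₀ + √(1 - r²)√(1 -
c₀²) (`sq_covariance_sub_mul_le`, `le_of_sq_sub_mul_le`). Equality holds for a combination of Y and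
Z with nonnegative coefficients. Because g is concave, γ is non-decreasing, so this combination is
non-decreasing and the formulas for risk and distance apply to it
(`exists_monotoneOn_covariance_eq`).

The passage to return vectors loses nothing: every univariate law with the right mean and variance
is a loss law (`exists_hasMoments_lossLaw_eq`). -/

instance isProbabilityMeasure_unif : IsProbabilityMeasure unif :=
  ⟨by simp [unif]⟩

theorem aemeasurable_unif_of_monotoneOn {Q : ℝ → ℝ} (hQ : MonotoneOn Q (Ioo 0 1)) :
    AEMeasurable Q unif :=
  aemeasurable_restrict_of_monotoneOn measurableSet_Ioo hQ

theorem isProbabilityMeasure_map_unif {Q : ℝ → ℝ} (hQ : MonotoneOn Q (Ioo 0 1)) :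
    IsProbabilityMeasure (unif.map Q) :=
  Measure.isProbabilityMeasure_map (aemeasurable_unif_of_monotoneOn hQ)

theorem ae_unif_mem_Ioo : ∀ᵐ u ∂unif, u ∈ Ioo (0 : ℝ) 1 :=
  ae_restrict_mem measurableSet_Ioo

/-- A sublevel set of Q is an initial interval of (0, 1) of length `cdf (unif.map Q) y`. Only its
right endpoint is in doubt, since Q need not be left-continuous; hence the almost-everywhere form.
-/
theorem ae_le_iff_le_cdf_map {Q : ℝ → ℝ} (hQ : MonotoneOn Q (Ioo 0 1)) (y : ℝ) :
    ∀ᵐ u ∂unif, (Q u ≤ y ↔ u ≤ cdf (unif.map Q) y) := by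
  have := isProbabilityMeasure_map_unif hQ
  have hQm := aemeasurable_unif_of_monotoneOn hQ
  set t := cdf (unif.map Q) y with ht
  set A : Set ℝ := {u | u ∈ Ioo (0 : ℝ) 1 ∧ Q u ≤ y} with hA
  have hvol : volume A = ENNReal.ofReal t := by
    rw [ht, ofReal_cdf, Measure.map_apply_of_aemeasurable hQm measurableSet_Iic, unif,
      Measure.restrict_apply' measurableSet_Ioo]
    congr 1
    ext u
    simp [hA, and_comm]
  have hsub : A ⊆ Ioc 0 t := by
    rintro s ⟨hs, hsy⟩
    refine ⟨hs.1, ?_⟩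
    have hle : volume (Ioo 0 s) ≤ volume A := measure_mono fun v hv =>
      ⟨⟨hv.1, hv.2.trans hs.2⟩, (hQ ⟨hv.1, hv.2.trans hs.2⟩ hs hv.2.le).trans hsy⟩
    rw [hvol, Real.volume_Ioo, sub_zero] at hle
    exact (ENNReal.ofReal_le_ofReal_iff (cdf_nonneg _ _)).1 hle
  have hnull : volume (Ioc 0 t \ A) = 0 := by
    have hAm : NullMeasurableSet A volume := by
      have : A.OrdConnected := ⟨fun a ha b hb c hc =>
        ⟨⟨ha.1.1.trans_le hc.1, hc.2.trans_lt hb.1.2⟩,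
          (hQ ⟨ha.1.1.trans_le hc.1, hc.2.trans_lt hb.1.2⟩ hb.1 hc.2).trans hb.2⟩⟩
      exact this.measurableSet.nullMeasurableSet
    rw [measure_sdiff hsub hAm (by simp [hvol]), hvol]
    simp
  rw [unif, ae_restrict_iff' measurableSet_Ioo]
  have : ∀ᵐ u, u ∉ Ioc 0 t \ A := measure_eq_zero_iff_ae_notMem.1 hnull
  filter_upwards [this] with u hu hu01
  refine ⟨fun h => (hsub ⟨hu01, h⟩).2, fun h => ?_⟩
  by_contra hc
  exact hu ⟨⟨hu01.1, h⟩, fun hA' => hc hA'.2⟩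

theorem quantile_le_iff (F : Measure ℝ) [IsProbabilityMeasure F] {u : ℝ} (hu : u ∈ Ioo (0 : ℝ) 1)
    (y : ℝ) : quantile F u ≤ y ↔ u ≤ cdf F y := by
  have hne : {y : ℝ | u ≤ cdf F y}.Nonempty :=
    ((tendsto_cdf_atTop F).eventually (eventually_ge_nhds hu.2)).exists
  have hbdd : BddBelow {y : ℝ | u ≤ cdf F y} := by
    obtain ⟨y₀, hy₀⟩ := ((tendsto_cdf_atBot F).eventually (eventually_lt_nhds hu.1)).exists
    refine ⟨y₀, fun y hy => ?_⟩
    by_contra! h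
    exact absurd (hy.trans (monotone_cdf F h.le)) (not_le.2 hy₀)
  refine ⟨fun h => ?_, fun h => csInf_le hbdd h⟩
  have hgt : ∀ z, y < z → u ≤ cdf F z := fun z hz => by
    obtain ⟨w, hw, hwz⟩ := exists_lt_of_csInf_lt hne (lt_of_le_of_lt h hz)
    exact (show u ≤ cdf F w from hw).trans (monotone_cdf F hwz.le)
  have hright : Filter.Tendsto (cdf F) (nhdsWithin y (Ioi y)) (nhds (cdf F y)) :=
    ((cdf F).right_continuous y).mono Ioi_subset_Ici_self
  exact ge_of_tendsto hright (by filter_upwards [self_mem_nhdsWithin] with z hz using hgt z hz)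

theorem monotoneOn_quantile (F : Measure ℝ) [IsProbabilityMeasure F] :
    MonotoneOn (quantile F) (Ioo 0 1) := fun _ hu _ hv huv =>
  (quantile_le_iff F hu _).2 (huv.trans ((quantile_le_iff F hv _).1 le_rfl))

theorem unif_Iic {t : ℝ} (h1 : t ≤ 1) : unif (Iic t) = ENNReal.ofReal t := by
  rw [unif, Measure.restrict_apply measurableSet_Iic]
  have : (Iic t ∩ Ioo 0 1 : Set ℝ) =ᵐ[volume] (Ioc 0 t : Set ℝ) := by
    have h : (Ioc 0 t ∩ Ioc 0 1 : Set ℝ) =ᵐ[volume] (Iic t ∩ Ioo 0 1 : Set ℝ) := by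
      have : (Iic t ∩ Ioc 0 1 : Set ℝ) = Ioc 0 t ∩ Ioc 0 1 := by
        ext; simp; tauto
      rw [← this]
      exact (ae_eq_set_inter (ae_eq_refl _) Ioo_ae_eq_Ioc).symm
    rw [inter_eq_left.2 (Ioc_subset_Ioc_right h1)] at h
    exact h.symm
  rw [measure_congr this]
  simp

theorem unif_Ioc {a b : ℝ} (ha : 0 ≤ a) (hb : b ≤ 1) :
    unif (Ioc a b) = ENNReal.ofReal (b - a) := by
  rcases le_or_gt b a with h | h
  · simp [h]
  · have hd : (Ioc a b : Set ℝ) = Iic b \ Iic a := by ext; simp [and_comm]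
    rw [hd, measure_sdiff (Iic_subset_Iic.2 h.le) nullMeasurableSet_Iic (by simp),
      unif_Iic hb, unif_Iic (h.le.trans hb), ENNReal.ofReal_sub _ ha]

theorem map_quantile_unif (F : Measure ℝ) [IsProbabilityMeasure F] :
    unif.map (quantile F) = F := by
  have := isProbabilityMeasure_map_unif (monotoneOn_quantile F)
  refine Measure.eq_of_cdf _ _ ?_
  ext y
  rw [cdf_eq_real, map_measureReal_apply_of_aemeasurable
    (aemeasurable_unif_of_monotoneOn (monotoneOn_quantile F)) measurableSet_Iic, measureReal_def]
  have : (quantile F ⁻¹' Iic y : Set ℝ) =ᵐ[unif] Iic (cdf F y) := by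
    filter_upwards [ae_unif_mem_Ioo] with u hu
    exact propext (quantile_le_iff F hu y)
  rw [measure_congr this, unif_Iic (cdf_le_one _ _), ENNReal.toReal_ofReal (cdf_nonneg _ _)]

/-! ## Optimality of the comonotone coupling -/

/-- The square is read as the area of [x, y)² or [y, x)², one of which is empty. Integrating over a
coupling and applying Tonelli then turns the cost into probabilities of corner events. -/
theorem ofReal_sq_sub_eq (x y : ℝ) : ENNReal.ofReal ((x - y) ^ 2)
    = volume (Ico x y ×ˢ Ico x y) + volume (Ico y x ×ˢ Ico y x) := by
  rw [Measure.volume_eq_prod, Measure.prod_prod, Measure.prod_prod]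
  simp only [Real.volume_Ico]
  rcases le_total x y with h | h
  · rw [ENNReal.ofReal_of_nonpos (sub_nonpos.2 h), zero_mul, add_zero,
      ← ENNReal.ofReal_mul (by linarith)]
    congr 1
    ring
  · rw [ENNReal.ofReal_of_nonpos (sub_nonpos.2 h), zero_mul, zero_add,
      ← ENNReal.ofReal_mul (by linarith)]
    congr 1
    ring

theorem lintegral_volume_Ico_prod (π : Measure (ℝ × ℝ)) [SFinite π] (f g : ℝ × ℝ → ℝ)
    (hf : Measurable f) (hg : Measurable g) :
    ∫⁻ p, volume (Ico (f p) (g p) ×ˢ Ico (f p) (g p)) ∂π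
      = ∫⁻ q : ℝ × ℝ, π {p | f p ≤ min q.1 q.2 ∧ max q.1 q.2 < g p} := by
  set B : Set ((ℝ × ℝ) × (ℝ × ℝ)) :=
    {z | f z.1 ≤ min z.2.1 z.2.2 ∧ max z.2.1 z.2.2 < g z.1} with hB
  have hBm : MeasurableSet B := by
    have h₁ : Measurable fun z : (ℝ × ℝ) × (ℝ × ℝ) => f z.1 := by fun_prop
    have h₂ : Measurable fun z : (ℝ × ℝ) × (ℝ × ℝ) => g z.1 := by fun_prop
    have h₃ : Measurable fun z : (ℝ × ℝ) × (ℝ × ℝ) => min z.2.1 z.2.2 := by fun_prop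
    have h₄ : Measurable fun z : (ℝ × ℝ) × (ℝ × ℝ) => max z.2.1 z.2.2 := by fun_prop
    exact (measurableSet_le h₁ h₃).inter (measurableSet_lt h₄ h₂)
  have h1 := Measure.prod_apply (μ := π) (ν := (volume : Measure (ℝ × ℝ))) hBm
  rw [Measure.prod_apply_symm hBm] at h1
  refine Eq.trans ?_ (h1.symm.trans ?_)
  · refine lintegral_congr fun p => ?_
    congr 1
    ext q
    simp [hB]
    tauto
  · rfl

theorem lintegral_sq_sub_eq (π : Measure (ℝ × ℝ)) [SFinite π] :
    ∫⁻ p, ENNReal.ofReal ((p.1 - p.2) ^ 2) ∂π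
      = (∫⁻ q : ℝ × ℝ, π {p | p.1 ≤ min q.1 q.2 ∧ max q.1 q.2 < p.2})
        + ∫⁻ q : ℝ × ℝ, π {p | p.2 ≤ min q.1 q.2 ∧ max q.1 q.2 < p.1} := by
  simp_rw [ofReal_sq_sub_eq]
  rw [← lintegral_volume_Ico_prod π _ _ measurable_fst measurable_snd,
    ← lintegral_volume_Ico_prod π _ _ measurable_snd measurable_fst, ← lintegral_add_left]
  simp only [Measure.volume_eq_prod, Measure.prod_prod, Real.volume_Ico]
  fun_prop

theorem measurableSet_le_and_lt (a b : ℝ) : MeasurableSet {p : ℝ × ℝ | p.1 ≤ a ∧ b < p.2} :=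
  (measurableSet_le measurable_fst measurable_const).inter
    (measurableSet_lt measurable_const measurable_snd)

theorem measurableSet_le_and_lt_swap (a b : ℝ) :
    MeasurableSet {p : ℝ × ℝ | p.2 ≤ a ∧ b < p.1} :=
  (measurableSet_le measurable_snd measurable_const).inter
    (measurableSet_lt measurable_const measurable_fst)

/-- The lower bound depends on the marginals alone; by `unif_le_and_lt` the comonotone coupling
attains it for every a and b simultaneously. -/
theorem ofReal_cdf_sub_cdf_le {F G : Measure ℝ} [IsProbabilityMeasure F] [IsProbabilityMeasure G]
    {π : Measure (ℝ × ℝ)} (h1 : π.map Prod.fst = F) (h2 : π.map Prod.snd = G) (a b : ℝ) :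
    ENNReal.ofReal (cdf F a - cdf G b) ≤ π {p | p.1 ≤ a ∧ b < p.2} := by
  rw [ENNReal.ofReal_sub _ (cdf_nonneg _ _), ofReal_cdf, ofReal_cdf, tsub_le_iff_right]
  rw [← h1, ← h2, Measure.map_apply measurable_fst measurableSet_Iic,
    Measure.map_apply measurable_snd measurableSet_Iic]
  refine (measure_mono fun p hp => ?_).trans (measure_union_le _ _)
  by_cases h : p.2 ≤ b
  · exact Or.inr h
  · exact Or.inl ⟨hp, not_le.1 h⟩

theorem unif_le_and_lt {Q₁ Q₂ : ℝ → ℝ} (h₁ : MonotoneOn Q₁ (Ioo 0 1))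
    (h₂ : MonotoneOn Q₂ (Ioo 0 1)) (a b : ℝ) :
    unif {u | Q₁ u ≤ a ∧ b < Q₂ u}
      = ENNReal.ofReal (cdf (unif.map Q₁) a - cdf (unif.map Q₂) b) := by
  rw [← unif_Ioc (cdf_nonneg _ _) (cdf_le_one _ _)]
  refine measure_congr ?_
  filter_upwards [ae_le_iff_le_cdf_map h₁ a, ae_le_iff_le_cdf_map h₂ b] with u hu hv
  refine propext ?_
  change (Q₁ u ≤ a ∧ b < Q₂ u) ↔ (_ < u ∧ u ≤ _)
  rw [hu, ← not_le, hv, not_le, and_comm]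

/-- The comonotone coupling minimises the quadratic transport cost. -/
theorem lintegral_sq_sub_le_of_coupling {Q₁ Q₂ : ℝ → ℝ} (h₁ : MonotoneOn Q₁ (Ioo 0 1))
    (h₂ : MonotoneOn Q₂ (Ioo 0 1)) {π : Measure (ℝ × ℝ)}
    (hπ : π ∈ couplings (unif.map Q₁) (unif.map Q₂)) :
    ∫⁻ u, ENNReal.ofReal ((Q₁ u - Q₂ u) ^ 2) ∂unif
      ≤ ∫⁻ p, ENNReal.ofReal ((p.1 - p.2) ^ 2) ∂π := by
  have hm₁ := aemeasurable_unif_of_monotoneOn h₁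
  have hm₂ := aemeasurable_unif_of_monotoneOn h₂
  have := isProbabilityMeasure_map_unif h₁
  have := isProbabilityMeasure_map_unif h₂
  have hπp : IsProbabilityMeasure π := by
    refine ⟨?_⟩
    have := measure_univ (μ := unif.map Q₁)
    rwa [← hπ.1, Measure.map_apply measurable_fst .univ, preimage_univ] at this
  have hpair : AEMeasurable (fun u => (Q₁ u, Q₂ u)) unif := hm₁.prodMk hm₂
  have : IsProbabilityMeasure (unif.map fun u => (Q₁ u, Q₂ u)) :=
    Measure.isProbabilityMeasure_map hpair
  have hmap : ∫⁻ u, ENNReal.ofReal ((Q₁ u - Q₂ u) ^ 2) ∂unif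
      = ∫⁻ p, ENNReal.ofReal ((p.1 - p.2) ^ 2) ∂(unif.map fun u => (Q₁ u, Q₂ u)) := by
    rw [lintegral_map' (by fun_prop) hpair]
  rw [hmap, lintegral_sq_sub_eq, lintegral_sq_sub_eq]
  refine add_le_add (lintegral_mono fun q => ?_) (lintegral_mono fun q => ?_)
  · refine le_trans (le_of_eq ?_) (ofReal_cdf_sub_cdf_le hπ.1 hπ.2 _ _)
    rw [Measure.map_apply_of_aemeasurable hpair (measurableSet_le_and_lt _ _),
      ← unif_le_and_lt h₁ h₂]
    rfl
  -- The opposite corner event is the first one for the swapped coupling.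
  · refine le_trans (le_of_eq ?_) ((ofReal_cdf_sub_cdf_le (π := π.map Prod.swap) (F := unif.map Q₂)
      (G := unif.map Q₁) ?_ ?_ (min q.1 q.2) (max q.1 q.2)).trans (le_of_eq ?_))
    · rw [Measure.map_apply_of_aemeasurable hpair (measurableSet_le_and_lt_swap _ _),
        ← unif_le_and_lt h₂ h₁]
      rfl
    · rw [Measure.map_map measurable_fst measurable_swap]
      exact hπ.2
    · rw [Measure.map_map measurable_snd measurable_swap]
      exact hπ.1
    · rw [Measure.map_apply measurable_swap (measurableSet_le_and_lt _ _)]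
      rfl

/-! ## The weight function and the quantile representation of distortion risk measures -/

/-- Concavity makes the left derivative non-increasing, and u ↦ 1 - u reverses the order. -/
theorem monotoneOn_weight {g : ℝ → ℝ} (hg : ConcaveOn ℝ (Icc 0 1) g) :
    MonotoneOn (weight g) (Ioo 0 1) := by
  intro u hu v hv huv
  have hint : ∀ w ∈ Ioo (0 : ℝ) 1, 1 - w ∈ interior (Icc (0 : ℝ) 1) := fun w hw => by
    rw [interior_Icc]
    exact ⟨by linarith [hw.2], by linarith [hw.1]⟩
  have h := hg.neg.monotoneOn_leftDeriv (hint v hv) (hint u hu) (by linarith)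
  simp only [derivWithin.neg, neg_le_neg_iff] at h
  exact h

theorem weight_nonneg {g : ℝ → ℝ} (hg : MonotoneOn g (Icc 0 1)) {u : ℝ} (hu : u ∈ Ioo (0 : ℝ) 1) :
    0 ≤ weight g u := by
  -- Monotonicity of g is known only on [0, 1], so the left derivative is first localised there.
  have h : weight g u = derivWithin g (Ioo 0 (1 - u)) (1 - u) := by
    refine derivWithin_congr_set ?_
    filter_upwards [Ioi_mem_nhds (show (0 : ℝ) < 1 - u by linarith [hu.2])] with x hx
    exact propext ⟨fun h => ⟨hx, h⟩, fun h => h.2⟩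
  rw [h]
  have hsub : Ioo 0 (1 - u) ⊆ Icc (0 : ℝ) 1 := fun x hx => ⟨hx.1.le, by linarith [hx.2, hu.1]⟩
  exact (hg.mono hsub).derivWithin_nonneg

theorem ae_weight_eq_deriv {g : ℝ → ℝ} (hgac : AbsolutelyContinuousOnInterval g 0 1) :
    ∀ᵐ u, u ∈ Icc (0 : ℝ) 1 → weight g u = deriv g (1 - u) := by
  have h := hgac.ae_differentiableAt
  have h' := (Measure.measurePreserving_sub_left volume (1 : ℝ)).quasiMeasurePreserving.ae h
  filter_upwards [h'] with u hu hu01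
  have := hu (by rw [uIcc_of_le zero_le_one]; exact ⟨by linarith [hu01.2], by linarith [hu01.1]⟩)
  exact this.derivWithin (uniqueDiffWithinAt_Iio _)

theorem intervalIntegrable_weight {g : ℝ → ℝ} (hgac : AbsolutelyContinuousOnInterval g 0 1)
    {a b : ℝ} (ha : 0 ≤ a) (hab : a ≤ b) (hb : b ≤ 1) :
    IntervalIntegrable (weight g) volume a b := by
  have h1 := (hgac.intervalIntegrable_deriv.comp_sub_left 1).symm
  simp only [sub_self, sub_zero] at h1
  have h2 : IntervalIntegrable (fun u => deriv g (1 - u)) volume a b := by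
    refine h1.mono_set ?_
    rw [uIcc_of_le hab, uIcc_of_le zero_le_one]
    exact Icc_subset_Icc ha hb
  refine h2.congr_ae ?_
  rw [Filter.EventuallyEq, ae_restrict_iff' measurableSet_uIoc, uIoc_of_le hab]
  filter_upwards [ae_weight_eq_deriv hgac] with u hu hu'
  exact (hu ⟨ha.trans hu'.1.le, hu'.2.trans hb⟩).symm

theorem integral_weight {g : ℝ → ℝ} (hgac : AbsolutelyContinuousOnInterval g 0 1)
    {a b : ℝ} (ha : 0 ≤ a) (hab : a ≤ b) (hb : b ≤ 1) :
    ∫ u in a..b, weight g u = g (1 - a) - g (1 - b) := by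
  have h1 : ∫ u in a..b, weight g u = ∫ u in a..b, deriv g (1 - u) := by
    refine intervalIntegral.integral_congr_ae ?_
    rw [uIoc_of_le hab]
    filter_upwards [ae_weight_eq_deriv hgac] with u hu hu'
    exact hu ⟨ha.trans hu'.1.le, hu'.2.trans hb⟩
  rw [h1, intervalIntegral.integral_comp_sub_left (fun x => deriv g x)]
  refine AbsolutelyContinuousOnInterval.integral_deriv_eq_sub (hgac.mono ?_)
  rw [uIcc_of_le (by linarith), uIcc_of_le zero_le_one]
  exact Icc_subset_Icc (by linarith) (by linarith)

theorem restrict_unif_Ioc {a b : ℝ} (ha : 0 ≤ a) (hb : b ≤ 1) :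
    unif.restrict (Ioc a b) = volume.restrict (Ioc a b) := by
  rw [unif, restrict_Ioo_eq_restrict_Ioc, Measure.restrict_restrict measurableSet_Ioc,
    inter_eq_left.2 (Ioc_subset_Ioc ha hb)]

theorem ae_weight_nonneg {g : ℝ → ℝ} (hg : MonotoneOn g (Icc 0 1)) :
    ∀ᵐ u ∂unif, 0 ≤ weight g u := by
  filter_upwards [ae_unif_mem_Ioo] with u hu using weight_nonneg hg hu

theorem setLIntegral_weight {g : ℝ → ℝ} (hg : MonotoneOn g (Icc 0 1))
    (hgac : AbsolutelyContinuousOnInterval g 0 1)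
    {a b : ℝ} (ha : 0 ≤ a) (hab : a ≤ b) (hb : b ≤ 1) :
    ∫⁻ u in Ioc a b, ENNReal.ofReal (weight g u) ∂unif
      = ENNReal.ofReal (g (1 - a) - g (1 - b)) := by
  rw [← integral_weight hgac ha hab hb, intervalIntegral.integral_of_le hab,
    ofReal_integral_eq_lintegral_ofReal, restrict_unif_Ioc ha hb]
  · exact (intervalIntegrable_iff_integrableOn_Ioc_of_le hab).1
      (intervalIntegrable_weight hgac ha hab hb)
  · rw [← restrict_unif_Ioc ha hb]
    exact ae_restrict_of_ae (ae_weight_nonneg hg)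

theorem integral_weight_unif {g : ℝ → ℝ} (hg : IsDistortion g)
    (hgac : AbsolutelyContinuousOnInterval g 0 1) : ∫ u, weight g u ∂unif = 1 := by
  have := integral_weight hgac le_rfl zero_le_one le_rfl
  rw [intervalIntegral.integral_of_le zero_le_one] at this
  rw [unif, restrict_Ioo_eq_restrict_Ioc, this]
  simp [hg.one, hg.zero]

/-- Under the measure with density γ, the fundamental theorem of calculus gives {Q > y} the mass g(1
- G(y)). The layer-cake formula for the positive and negative parts of Q then produces the two
Choquet integrals. Both are finite because γ and Q are square integrable, so the subtraction in
`EReal` is an honest one. -/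
theorem distortionRisk_map_unif {g : ℝ → ℝ} (hg : IsDistortion g)
    (hgac : AbsolutelyContinuousOnInterval g 0 1) (hγ : MemLp (weight g) 2 unif)
    {Q : ℝ → ℝ} (hQ : MonotoneOn Q (Ioo 0 1)) (hQ2 : MemLp Q 2 unif) :
    distortionRisk g (unif.map Q) = ((∫ u, weight g u * Q u ∂unif : ℝ) : EReal) := by
  set ν : Measure ℝ := unif.withDensity fun u => ENNReal.ofReal (weight g u) with hν
  have hQm := aemeasurable_unif_of_monotoneOn hQ
  have hγm : AEMeasurable (fun u => ENNReal.ofReal (weight g u)) unif :=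
    hγ.aestronglyMeasurable.aemeasurable.ennreal_ofReal
  have hac : ν ≪ unif := withDensity_absolutelyContinuous _ _
  have hlow : ∀ y, ν {u | Q u ≤ y} = ENNReal.ofReal (1 - g (1 - cdf (unif.map Q) y)) := by
    intro y
    have hset : ({u | Q u ≤ y} : Set ℝ) =ᵐ[unif] (Ioc 0 (cdf (unif.map Q) y) : Set ℝ) := by
      filter_upwards [ae_le_iff_le_cdf_map hQ y, ae_unif_mem_Ioo] with u hu hu0
      exact propext (hu.trans ⟨fun h => ⟨hu0.1, h⟩, fun h => h.2⟩)
    rw [hν, withDensity_apply', setLIntegral_congr hset,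
      setLIntegral_weight hg.monotoneOn hgac le_rfl (cdf_nonneg _ _) (cdf_le_one _ _), sub_zero,
      hg.one]
  have hhigh : ∀ y, ν {u | y < Q u} = ENNReal.ofReal (g (1 - cdf (unif.map Q) y)) := by
    intro y
    have hset : ({u | y < Q u} : Set ℝ) =ᵐ[unif] (Ioc (cdf (unif.map Q) y) 1 : Set ℝ) := by
      filter_upwards [ae_le_iff_le_cdf_map hQ y, ae_unif_mem_Ioo] with u hu hu0
      refine propext ?_
      change y < Q u ↔ _ < u ∧ u ≤ 1
      rw [← not_le, hu, not_le]
      exact ⟨fun h => ⟨h, hu0.2.le⟩, fun h => h.1⟩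
    rw [hν, withDensity_apply', setLIntegral_congr hset,
      setLIntegral_weight hg.monotoneOn hgac (cdf_nonneg _ _) (cdf_le_one _ _) le_rfl, sub_self,
      hg.zero, sub_zero]
  have hmul : ∀ f : ℝ → ℝ, AEMeasurable f unif →
      ∫⁻ u, ENNReal.ofReal (max (f u) 0) ∂ν = ∫⁻ u, ENNReal.ofReal (weight g u * f u) ∂unif := by
    intro f hf
    rw [hν, lintegral_withDensity_eq_lintegral_mul₀ hγm (hf.max aemeasurable_const).ennreal_ofReal]
    refine lintegral_congr_ae ?_
    filter_upwards [ae_weight_nonneg hg.monotoneOn] with u hu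
    rw [Pi.mul_apply, ENNReal.ofReal_mul hu]
    simp
  have hpos : ∫⁻ x in Ioi (0 : ℝ), ENNReal.ofReal (g (1 - cdf (unif.map Q) x))
      = ∫⁻ u, ENNReal.ofReal (weight g u * Q u) ∂unif := by
    rw [← hmul Q hQm, lintegral_eq_lintegral_meas_lt ν (f := fun u => max (Q u) 0)
      (ae_of_all _ fun u => le_max_right _ _)
      ((hQm.mono_ac hac).max aemeasurable_const)]
    refine setLIntegral_congr_fun measurableSet_Ioi fun y hy => ?_
    simp only [← hhigh, lt_max_iff, not_lt.2 (le_of_lt (mem_Ioi.1 hy)), or_false]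
  have hneg : ∫⁻ x in Iio (0 : ℝ), ENNReal.ofReal (1 - g (1 - cdf (unif.map Q) x))
      = ∫⁻ u, ENNReal.ofReal (-(weight g u * Q u)) ∂unif := by
    simp only [← mul_neg]
    -- The non-strict layer-cake formula is used here: y ≤ -Q means Q ≤ -y, which is exactly a
    -- distribution-function event.
    rw [← hmul (fun u => -Q u) hQm.neg, lintegral_eq_lintegral_meas_le ν
      (f := fun u => max (-Q u) 0) (ae_of_all _ fun u => le_max_right _ _)
      ((hQm.neg.mono_ac hac).max aemeasurable_const)]
    have hpre : (Neg.neg ⁻¹' Iio (0 : ℝ)) = Ioi 0 := by ext; simp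
    rw [← (Measure.measurePreserving_neg (volume : Measure ℝ)).setLIntegral_comp_preimage_emb
      (MeasurableEquiv.neg ℝ).measurableEmbedding, hpre]
    refine setLIntegral_congr_fun measurableSet_Ioi fun y hy => ?_
    simp only [← hlow, le_max_iff, not_le.2 (mem_Ioi.1 hy), or_false, le_neg]
  have hint : Integrable (fun u => weight g u * Q u) unif := hγ.integrable_mul hQ2
  have h1 : ∫⁻ u, ENNReal.ofReal (weight g u * Q u) ∂unif ≠ ∞ := hint.lintegral_lt_top.ne
  have h2 : ∫⁻ u, ENNReal.ofReal (-(weight g u * Q u)) ∂unif ≠ ∞ := hint.neg.lintegral_lt_top.ne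
  rw [distortionRisk, hpos, hneg, integral_eq_lintegral_pos_part_sub_lintegral_neg_part hint,
    EReal.coe_sub]
  congr 1
  · exact (EReal.coe_ennreal_toReal h1).symm
  · exact (EReal.coe_ennreal_toReal h2).symm

variable {n : ℕ}

/-! ## Return vectors with a prescribed law of the portfolio loss -/

theorem covariance_sum_mul_left {Ω : Type*} [MeasurableSpace Ω] {P : Measure Ω}
    [IsProbabilityMeasure P] {X : Fin n → Ω → ℝ} {Y : Ω → ℝ} (hX : ∀ i, MemLp (X i) 2 P)
    (hY : MemLp Y 2 P) (x : Fin n → ℝ) :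
    covariance (fun ω => ∑ i, x i * X i ω) Y P = ∑ i, x i * covariance (X i) Y P := by
  rw [covariance_fun_sum_left (fun i => (hX i).const_mul (x i)) hY]
  simp_rw [covariance_const_mul_left]

theorem variance_dotProduct {Ω : Type*} [MeasurableSpace Ω] {P : Measure Ω}
    [IsProbabilityMeasure P] {X : Fin n → Ω → ℝ} (hX : ∀ i, MemLp (X i) 2 P)
    {S : Matrix (Fin n) (Fin n) ℝ} (hS : ∀ i j, covariance (X i) (X j) P = S i j)
    (x : Fin n → ℝ) :
    variance (fun ω => ∑ i, x i * X i ω) P = x ⬝ᵥ (S *ᵥ x) := by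
  have hsum : MemLp (fun ω => ∑ i, x i * X i ω) 2 P :=
    memLp_finsetSum _ fun i _ => (hX i).const_mul (x i)
  rw [← covariance_self hsum.aestronglyMeasurable.aemeasurable, covariance_sum_mul_left hX hsum]
  simp only [dotProduct, Matrix.mulVec]
  refine Finset.sum_congr rfl fun i _ => ?_
  rw [covariance_comm, covariance_sum_mul_left hX (hX i)]
  congr 1
  refine Finset.sum_congr rfl fun j _ => ?_
  rw [covariance_comm, hS, mul_comm]

theorem HasMoments.lossLaw_moments {R : Measure (Fin n → ℝ)} {m : Fin n → ℝ}
    {S : Matrix (Fin n) (Fin n) ℝ} (hR : HasMoments R m S) (x : Fin n → ℝ) :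
    IsProbabilityMeasure (lossLaw R x) ∧ MemLp (fun y : ℝ => y) 2 (lossLaw R x) ∧
      ∫ y, y ∂(lossLaw R x) = -portMean m x ∧
      variance (fun y : ℝ => y) (lossLaw R x) = x ⬝ᵥ (S *ᵥ x) := by
  have := hR.isProbabilityMeasure
  have hm : Measurable fun r : Fin n → ℝ => -(x ⬝ᵥ r) := by
    simp only [dotProduct]
    fun_prop
  have hsum : MemLp (fun r : Fin n → ℝ => ∑ i, x i * r i) 2 R :=
    memLp_finsetSum _ fun i _ => (hR.memLp i).const_mul (x i)
  refine ⟨Measure.isProbabilityMeasure_map hm.aemeasurable, ?_, ?_, ?_⟩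
  · rw [lossLaw, memLp_map_measure_iff (by fun_prop) hm.aemeasurable]
    exact hsum.neg
  · rw [lossLaw, integral_map hm.aemeasurable (by fun_prop), integral_neg]
    simp only [dotProduct, portMean]
    rw [integral_finsetSum _ fun i _ => ((hR.memLp i).integrable (by norm_num)).const_mul (x i)]
    simp_rw [integral_const_mul, hR.mean]
  · rw [lossLaw, variance_map (by fun_prop) hm.aemeasurable]
    change variance (fun r : Fin n → ℝ => -(x ⬝ᵥ r)) R = _
    rw [variance_fun_neg]
    exact variance_dotProduct hR.memLp hR.cov x

/-- The correction v W leaves the covariance unchanged: the two cross terms contribute -2s vᵢvⱼ, and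
the variance of W contributes 2s vᵢvⱼ. -/
theorem hasMoments_map_add_mul {Ω : Type*} [MeasurableSpace Ω] {P : Measure Ω}
    [IsProbabilityMeasure P] (m v : Fin n → ℝ) {S : Matrix (Fin n) (Fin n) ℝ}
    {Z : Fin n → Ω → ℝ} {W : Ω → ℝ} (hZm : ∀ i, Measurable (Z i)) (hWm : Measurable W)
    (hZ2 : ∀ i, MemLp (Z i) 2 P) (hW2 : MemLp W 2 P) (hZ0 : ∀ i, ∫ ω, Z i ω ∂P = 0)
    (hW0 : ∫ ω, W ω ∂P = 0) (hZZ : ∀ i j, covariance (Z i) (Z j) P = S i j)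
    {s : ℝ} (hWZ : ∀ i, covariance W (Z i) P = -(s * v i)) (hWW : covariance W W P = 2 * s) :
    HasMoments (P.map fun ω i => m i + Z i ω + v i * W ω) m S := by
  have hXm : Measurable fun ω i => m i + Z i ω + v i * W ω := measurable_pi_lambda _ fun i =>
    ((hZm i).const_add (m i)).add (hWm.const_mul (v i))
  have hY2 : ∀ i, MemLp (fun ω => m i + Z i ω) 2 P := fun i =>
    MemLp.add (memLp_const (m i)) (hZ2 i)
  have hV2 : ∀ i, MemLp (fun ω => v i * W ω) 2 P := fun i => hW2.const_mul (v i)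
  have hX2 : ∀ i, MemLp (fun ω => m i + Z i ω + v i * W ω) 2 P := fun i =>
    MemLp.add (hY2 i) (hV2 i)
  have hcX : ∀ i U, MemLp U 2 P → covariance (fun ω => m i + Z i ω + v i * W ω) U P
      = covariance (Z i) U P + v i * covariance W U P := by
    intro i U hU
    have h1 : covariance (fun ω => m i + Z i ω + v i * W ω) U P
        = covariance (fun ω => m i + Z i ω) U P + covariance (fun ω => v i * W ω) U P :=
      covariance_add_left (hY2 i) (hV2 i) hU
    have h2 : covariance (fun ω => m i + Z i ω) U P = covariance (Z i) U P :=
      covariance_const_add_left ((hZ2 i).integrable (by norm_num)) (m i)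
    rw [h1, h2, covariance_const_mul_left]
  refine ⟨Measure.isProbabilityMeasure_map hXm.aemeasurable, fun i => ?_, fun i => ?_,
    fun i j => ?_⟩
  · rw [memLp_map_measure_iff (measurable_pi_apply i).aestronglyMeasurable hXm.aemeasurable]
    exact hX2 i
  · rw [integral_map hXm.aemeasurable (measurable_pi_apply i).aestronglyMeasurable,
      integral_add ((hY2 i).integrable (by norm_num)) ((hV2 i).integrable (by norm_num)),
      integral_const_mul, hW0,
      integral_add (integrable_const _) ((hZ2 i).integrable (by norm_num)), hZ0]
    simp
  · rw [covariance_map_fun (measurable_pi_apply i).aestronglyMeasurable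
      (measurable_pi_apply j).aestronglyMeasurable hXm.aemeasurable, hcX _ _ (hX2 j),
      covariance_comm (Z i), covariance_comm W, hcX _ _ (hZ2 i), hcX _ _ hW2, hZZ, hWZ,
      covariance_comm (Z j), hWZ, hWW, ← hZZ, covariance_comm, hZZ]
    ring

/-- The component T = xᵀZ of the noise is exchanged for the prescribed K = -L - μ_x by adding (K -
T)v along v = Sx / xᵀSx. As xᵀv = 1, this gives xᵀR = μ_x + K = -L, and v is the regression
direction of Z on T, so the covariance matrix survives. -/
theorem exists_hasMoments_of_uncorrelated {Ω : Type*} [MeasurableSpace Ω] {P : Measure Ω}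
    [IsProbabilityMeasure P] {m : Fin n → ℝ} {S : Matrix (Fin n) (Fin n) ℝ}
    {x : Fin n → ℝ} (hx : 0 < x ⬝ᵥ (S *ᵥ x)) {Z : Fin n → Ω → ℝ} {L : Ω → ℝ}
    (hZm : ∀ i, Measurable (Z i)) (hLm : Measurable L)
    (hZ2 : ∀ i, MemLp (Z i) 2 P) (hL2 : MemLp L 2 P) (hZ0 : ∀ i, ∫ ω, Z i ω ∂P = 0)
    (hL0 : ∫ ω, L ω ∂P = -portMean m x) (hZZ : ∀ i j, covariance (Z i) (Z j) P = S i j)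
    (hLZ : ∀ i, covariance L (Z i) P = 0) (hLL : covariance L L P = x ⬝ᵥ (S *ᵥ x)) :
    ∃ R, HasMoments R m S ∧ lossLaw R x = P.map L := by
  set s := x ⬝ᵥ (S *ᵥ x) with hs
  let T : Ω → ℝ := fun ω => ∑ i, x i * Z i ω
  let K : Ω → ℝ := fun ω => -L ω - portMean m x
  let W : Ω → ℝ := fun ω => K ω - T ω
  let v : Fin n → ℝ := fun i => (S *ᵥ x) i / s
  have hT2 : MemLp T 2 P := memLp_finsetSum _ fun i _ => (hZ2 i).const_mul (x i)
  have hT0 : ∫ ω, T ω ∂P = 0 := by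
    simp only [T]
    rw [integral_finsetSum _ fun i _ => ((hZ2 i).integrable (by norm_num)).const_mul (x i)]
    simp_rw [integral_const_mul, hZ0]
    simp
  have hK2 : MemLp K 2 P := hL2.neg.sub (memLp_const _)
  have hK0 : ∫ ω, K ω ∂P = 0 := by
    have hLi : Integrable L P := hL2.integrable (by norm_num)
    simp only [K]
    rw [integral_sub hLi.fun_neg (integrable_const _), integral_neg, hL0]
    simp
  have hW2 : MemLp W 2 P := hK2.sub hT2
  have hW0 : ∫ ω, W ω ∂P = 0 := by
    simp only [W]
    rw [integral_sub (hK2.integrable (by norm_num)) (hT2.integrable (by norm_num)), hK0, hT0,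
      sub_zero]
  have hZT : ∀ i, covariance (Z i) T P = (S *ᵥ x) i := fun i => by
    rw [covariance_comm, covariance_sum_mul_left hZ2 (hZ2 i)]
    simp only [Matrix.mulVec, dotProduct]
    refine Finset.sum_congr rfl fun j _ => ?_
    rw [covariance_comm, hZZ, mul_comm]
  have hLT : covariance L T P = 0 := by
    rw [covariance_comm, covariance_sum_mul_left hZ2 hL2]
    refine Finset.sum_eq_zero fun i _ => ?_
    rw [covariance_comm, hLZ, mul_zero]
  have hTT : covariance T T P = s := by
    rw [covariance_self hT2.aestronglyMeasurable.aemeasurable]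
    exact variance_dotProduct hZ2 hZZ x
  have hcW : ∀ U, MemLp U 2 P → covariance W U P = -covariance L U P - covariance T U P := by
    intro U hU
    have h1 : covariance W U P = covariance K U P - covariance T U P :=
      covariance_fun_sub_left hK2 hT2 hU
    have h2 : covariance K U P = covariance (fun ω => -L ω) U P :=
      covariance_sub_const_left (hL2.neg.integrable (by norm_num)) _
    rw [h1, h2, covariance_fun_neg_left]
  have hWZ : ∀ i, covariance W (Z i) P = -(s * v i) := fun i => by
    rw [hcW _ (hZ2 i), hLZ, covariance_comm, hZT, mul_div_cancel₀ _ hx.ne']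
    ring
  have hWW : covariance W W P = 2 * s := by
    rw [hcW _ hW2, covariance_comm L, covariance_comm T, hcW _ hL2, hcW _ hT2, hLL, hLT,
      covariance_comm T L, hLT, hTT]
    ring
  have hTm : Measurable T := Finset.measurable_fun_sum _ fun i _ => (hZm i).const_mul (x i)
  have hKm : Measurable K := hLm.neg.sub_const _
  have hWm : Measurable W := hKm.sub hTm
  have hXm : Measurable fun ω i => m i + Z i ω + v i * W ω := measurable_pi_lambda _ fun i =>
    ((hZm i).const_add (m i)).add (hWm.const_mul (v i))
  refine ⟨_, hasMoments_map_add_mul m v hZm hWm hZ2 hW2 hZ0 hW0 hZZ hWZ hWW, ?_⟩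
  rw [lossLaw, Measure.map_map (by simp only [dotProduct]; fun_prop) hXm]
  congr 1
  ext ω
  have hv : x ⬝ᵥ v = 1 := by
    have : v = s⁻¹ • (S *ᵥ x) := by ext i; simp [v, div_eq_inv_mul]
    rw [this, dotProduct_smul, ← hs, smul_eq_mul, inv_mul_cancel₀ hx.ne']
  have hXe : (fun i => m i + Z i ω + v i * W ω) = m + (fun i => Z i ω) + W ω • v := by
    ext i
    simp [mul_comm]
  have hT : x ⬝ᵥ (fun i => Z i ω) = T ω := rfl
  rw [Function.comp_apply, hXe, dotProduct_add, dotProduct_add, dotProduct_smul, hv, hT]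
  simp only [W, K, portMean, smul_eq_mul]
  ring

/-- Every law on the line with the mean and the variance of the loss of `x` is the law of the loss
of `x` for some return vector with the given moments. -/
theorem exists_hasMoments_lossLaw_eq {m : Fin n → ℝ} {S : Matrix (Fin n) (Fin n) ℝ}
    (hS : S.PosSemidef) {x : Fin n → ℝ} (hx : 0 < x ⬝ᵥ (S *ᵥ x))
    (G : Measure ℝ) [IsProbabilityMeasure G] (hG : MemLp (fun y : ℝ => y) 2 G)
    (hmean : ∫ y, y ∂G = -portMean m x) (hvar : variance (fun y : ℝ => y) G = x ⬝ᵥ (S *ᵥ x)) :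
    ∃ R, HasMoments R m S ∧ lossLaw R x = G := by
  -- The Gaussian only supplies a centred vector with covariance S; taken independent of the loss,
  -- it is uncorrelated with it.
  let N : Measure (EuclideanSpace ℝ (Fin n)) := multivariateGaussian 0 S
  have hN2 : ∀ i, MemLp (fun z : EuclideanSpace ℝ (Fin n) => z i) 2 N := fun i =>
    IsGaussian.memLp_dual N (EuclideanSpace.proj i) 2 (by simp)
  have hN0 : ∀ i, ∫ z : EuclideanSpace ℝ (Fin n), z i ∂N = 0 := fun i => by
    have := (EuclideanSpace.proj (𝕜 := ℝ) i).integral_comp_comm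
      (μ := N) (φ := fun z : EuclideanSpace ℝ (Fin n) => z) IsGaussian.integrable_fun_id
    simpa [N] using this
  have hfst : (G.prod N).map Prod.fst = G := by simp
  have hsnd : (G.prod N).map Prod.snd = N := by simp
  have key := exists_hasMoments_of_uncorrelated (P := G.prod N) (m := m) (S := S) (x := x)
    (Z := fun i ω => ω.2 i) (L := Prod.fst) hx (by fun_prop) measurable_fst
    (fun i => (hN2 i).comp_snd G) (hG.comp_fst N) ?_ ?_ ?_
    (fun i => covariance_fst_snd_prod hG (hN2 i)) ?_
  · rwa [hfst] at key
  · intro i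
    have := integral_fun_snd (μ := G) (ν := N) (fun z : EuclideanSpace ℝ (Fin n) => z i)
    rw [this, hN0, smul_zero]
  · have := integral_fun_fst (μ := G) (ν := N) (fun y : ℝ => y)
    rw [this, hmean]
    simp
  · intro i j
    have h : covariance (fun z : EuclideanSpace ℝ (Fin n) => z i) (fun z => z j) N = S i j :=
      covariance_eval_multivariateGaussian hS i j
    rw [← hsnd, covariance_map_fun (by fun_prop) (by fun_prop) (by fun_prop)] at h
    exact h
  · rw [covariance_self measurable_fst.aemeasurable, ← hvar]
    conv_rhs => rw [← hfst]
    rw [variance_map (by fun_prop) (by fun_prop)]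
    rfl

/-! ## Covariance inequalities -/

theorem sq_covariance_le {Ω : Type*} [MeasurableSpace Ω] {P : Measure Ω} [IsProbabilityMeasure P]
    {X Y : Ω → ℝ} (hX : MemLp X 2 P) (hY : MemLp Y 2 P) :
    covariance X Y P ^ 2 ≤ variance X P * variance Y P := by
  have h : ∀ t : ℝ, 0 ≤ variance Y P * (t * t) + 2 * covariance X Y P * t + variance X P := by
    intro t
    have h1 := variance_nonneg (fun ω => X ω + t * Y ω) P
    rw [variance_fun_add hX (hY.const_mul t), variance_const_mul, covariance_const_mul_right] at h1
    linarith
  have := discrim_le_zero h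
  rw [discrim] at this
  linarith

/-- This is Cauchy–Schwarz for the residuals of X and Z after projection on Y. -/
theorem sq_covariance_sub_mul_le {Ω : Type*} [MeasurableSpace Ω] {P : Measure Ω}
    [IsProbabilityMeasure P] {X Y Z : Ω → ℝ} (hX : MemLp X 2 P) (hY : MemLp Y 2 P)
    (hZ : MemLp Z 2 P) (hX1 : variance X P = 1) (hY1 : variance Y P = 1)
    (hZ1 : variance Z P = 1) :
    (covariance X Z P - covariance X Y P * covariance Y Z P) ^ 2
      ≤ (1 - covariance X Y P ^ 2) * (1 - covariance Y Z P ^ 2) := by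
  set a := covariance X Y P with ha
  set c := covariance Y Z P with hc
  have hXa : MemLp (fun ω => X ω - a * Y ω) 2 P := hX.sub (hY.const_mul a)
  have hZc : MemLp (fun ω => Z ω - c * Y ω) 2 P := hZ.sub (hY.const_mul c)
  have h := sq_covariance_le hXa hZc
  rw [variance_fun_sub hX (hY.const_mul a), variance_fun_sub hZ (hY.const_mul c),
    covariance_fun_sub_fun_sub hX (hY.const_mul a) hZ (hY.const_mul c)] at h
  simp only [variance_const_mul, covariance_const_mul_right, covariance_const_mul_left,
    covariance_self hY.aestronglyMeasurable.aemeasurable, hX1, hY1, hZ1, ← ha,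
    covariance_comm Z Y, ← hc] at h
  nlinarith [h]

theorem le_of_sq_sub_mul_le {a c p r : ℝ} (hc : -1 ≤ c) (hcr : c ≤ r) (hra : r ≤ a) (ha : a ≤ 1)
    (h : (p - a * c) ^ 2 ≤ (1 - a ^ 2) * (1 - c ^ 2)) :
    p ≤ r * c + √(1 - r ^ 2) * √(1 - c ^ 2) := by
  have h1 : p ≤ a * c + √(1 - a ^ 2) * √(1 - c ^ 2) := by
    -- With c = cos θ and a = cos α, the bound is cos(θ - α). Lowering a to r narrows the gap θ - α
    -- while keeping it nonnegative, so the cosine grows.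
    rw [← Real.sqrt_mul (by nlinarith)]
    linarith [Real.le_sqrt_of_sq_le h]
  have h2 : ∀ t, c ≤ t → t ≤ 1 → t * c + √(1 - t ^ 2) * √(1 - c ^ 2)
      = Real.cos (Real.arccos c - Real.arccos t) := by
    intro t hct ht
    rw [Real.cos_sub, Real.sin_arccos, Real.sin_arccos, Real.cos_arccos hc (by linarith),
      Real.cos_arccos (by linarith) ht]
    ring
  rw [h2 a (by linarith) ha] at h1
  rw [h2 r hcr (by linarith)]
  refine h1.trans (Real.cos_le_cos_of_nonneg_of_le_pi ?_ ?_ ?_)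
  · linarith [Real.arccos_le_arccos hcr]
  · linarith [Real.arccos_le_pi c, Real.arccos_nonneg a]
  · linarith [Real.arccos_le_arccos hra]

theorem lintegral_sq_sub_eq_ofReal {Ω : Type*} [MeasurableSpace Ω] {P : Measure Ω}
    [IsProbabilityMeasure P] {X Y : Ω → ℝ} (hX : MemLp X 2 P) (hY : MemLp Y 2 P) :
    ∫⁻ ω, ENNReal.ofReal ((X ω - Y ω) ^ 2) ∂P
      = ENNReal.ofReal (variance X P - 2 * covariance X Y P + variance Y P
          + ((∫ ω, X ω ∂P) - ∫ ω, Y ω ∂P) ^ 2) := by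
  have hXY : MemLp (fun ω => X ω - Y ω) 2 P := hX.sub hY
  rw [← ofReal_integral_eq_lintegral_ofReal hXY.integrable_sq (ae_of_all _ fun _ => sq_nonneg _),
    ← variance_fun_sub hX hY, variance_eq_sub hXY,
    ← integral_sub (hX.integrable (by norm_num)) (hY.integrable (by norm_num))]
  congr 1
  simp

theorem wasserstein_map_unif {Q₁ Q₂ : ℝ → ℝ} (h₁ : MonotoneOn Q₁ (Ioo 0 1))
    (h₂ : MonotoneOn Q₂ (Ioo 0 1)) :
    wasserstein (unif.map Q₁) (unif.map Q₂)
      = (∫⁻ u, ENNReal.ofReal ((Q₁ u - Q₂ u) ^ 2) ∂unif) ^ (1 / 2 : ℝ) := by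
  have hm₁ := aemeasurable_unif_of_monotoneOn h₁
  have hm₂ := aemeasurable_unif_of_monotoneOn h₂
  have hpair : AEMeasurable (fun u => (Q₁ u, Q₂ u)) unif := hm₁.prodMk hm₂
  refine le_antisymm ?_ (le_iInf₂ fun π hπ => ?_)
  · refine (iInf₂_le (unif.map fun u => (Q₁ u, Q₂ u)) ⟨?_, ?_⟩).trans (le_of_eq ?_)
    · rw [lintegral_map' (by fun_prop) hpair]
    · rw [AEMeasurable.map_map_of_aemeasurable measurable_fst.aemeasurable hpair]
      rfl
    · rw [AEMeasurable.map_map_of_aemeasurable measurable_snd.aemeasurable hpair]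
      rfl
  · exact ENNReal.rpow_le_rpow (lintegral_sq_sub_le_of_coupling h₁ h₂ hπ) (by norm_num)

/-- The comonotone coupling costs no more than the independent one; the two costs differ by twice
the covariance. -/
theorem covariance_nonneg_of_monotoneOn {Q₁ Q₂ : ℝ → ℝ} (h₁ : MonotoneOn Q₁ (Ioo 0 1))
    (h₂ : MonotoneOn Q₂ (Ioo 0 1)) (hQ₁ : MemLp Q₁ 2 unif) (hQ₂ : MemLp Q₂ 2 unif) :
    0 ≤ covariance Q₁ Q₂ unif := by
  have hm₁ := aemeasurable_unif_of_monotoneOn h₁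
  have hm₂ := aemeasurable_unif_of_monotoneOn h₂
  have hf : MemLp (fun p : ℝ × ℝ => Q₁ p.1) 2 (unif.prod unif) := hQ₁.comp_fst unif
  have hs : MemLp (fun p : ℝ × ℝ => Q₂ p.2) 2 (unif.prod unif) := hQ₂.comp_snd unif
  have hfst : (unif.prod unif).map Prod.fst = unif := by simp
  have hsnd : (unif.prod unif).map Prod.snd = unif := by simp
  have hpair : AEMeasurable (fun p : ℝ × ℝ => (Q₁ p.1, Q₂ p.2)) (unif.prod unif) :=
    hf.aestronglyMeasurable.aemeasurable.prodMk hs.aestronglyMeasurable.aemeasurable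
  have h := lintegral_sq_sub_le_of_coupling h₁ h₂
    (π := (unif.prod unif).map fun p : ℝ × ℝ => (Q₁ p.1, Q₂ p.2)) ⟨?_, ?_⟩
  · rw [lintegral_map' (by fun_prop) hpair, lintegral_sq_sub_eq_ofReal hQ₁ hQ₂,
      lintegral_sq_sub_eq_ofReal hf hs, covariance_fst_snd_prod hQ₁ hQ₂,
      integral_fun_fst, integral_fun_snd] at h
    have e1 : variance (fun p : ℝ × ℝ => Q₁ p.1) (unif.prod unif) = variance Q₁ unif := by
      have := variance_map (μ := unif.prod unif) (Y := Prod.fst) (X := Q₁)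
        (by rwa [hfst]) measurable_fst.aemeasurable
      rw [hfst] at this
      exact this.symm
    have e2 : variance (fun p : ℝ × ℝ => Q₂ p.2) (unif.prod unif) = variance Q₂ unif := by
      have := variance_map (μ := unif.prod unif) (Y := Prod.snd) (X := Q₂)
        (by rwa [hsnd]) measurable_snd.aemeasurable
      rw [hsnd] at this
      exact this.symm
    rw [e1, e2] at h
    simp only [probReal_univ, one_smul] at h
    have := variance_nonneg Q₁ unif
    have := variance_nonneg Q₂ unif
    have := sq_nonneg ((∫ u, Q₁ u ∂unif) - ∫ u, Q₂ u ∂unif)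
    rw [ENNReal.ofReal_le_ofReal_iff (by linarith)] at h
    linarith
  · rw [AEMeasurable.map_map_of_aemeasurable measurable_fst.aemeasurable hpair]
    conv_rhs => rw [← hfst]
    rw [AEMeasurable.map_map_of_aemeasurable (by rwa [hfst]) measurable_fst.aemeasurable]
    rfl
  · rw [AEMeasurable.map_map_of_aemeasurable measurable_snd.aemeasurable hpair]
    conv_rhs => rw [← hsnd]
    rw [AEMeasurable.map_map_of_aemeasurable (by rwa [hsnd]) measurable_snd.aemeasurable]
    rfl

/-! ## Moments of quantile functions and of the weight function -/

theorem memLp_quantile {G : Measure ℝ} [IsProbabilityMeasure G]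
    (hG : MemLp (fun y : ℝ => y) 2 G) : MemLp (quantile G) 2 unif := by
  rw [← map_quantile_unif G] at hG
  exact (memLp_map_measure_iff (by fun_prop)
    (aemeasurable_unif_of_monotoneOn (monotoneOn_quantile G))).1 hG

theorem integral_quantile (G : Measure ℝ) [IsProbabilityMeasure G] :
    ∫ u, quantile G u ∂unif = ∫ y, y ∂G := by
  conv_rhs => rw [← map_quantile_unif G]
  rw [integral_map (aemeasurable_unif_of_monotoneOn (monotoneOn_quantile G)) (by fun_prop)]

theorem variance_quantile (G : Measure ℝ) [IsProbabilityMeasure G] :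
    variance (quantile G) unif = variance (fun y : ℝ => y) G := by
  conv_rhs => rw [← map_quantile_unif G]
  rw [variance_map (by fun_prop) (aemeasurable_unif_of_monotoneOn (monotoneOn_quantile G))]
  rfl

theorem exists_mem_Ioo_of_ae_unif {p : ℝ → Prop} (hp : ∀ᵐ u ∂unif, p u) {a b : ℝ} (ha : 0 ≤ a)
    (hab : a < b) (hb : b ≤ 1) : ∃ u ∈ Ioo a b, p u := by
  by_contra! h
  have h1 : unif (Ioo a b) = 0 := measure_mono_null (fun u hu => h u hu) (ae_iff.1 hp)
  rw [unif, Measure.restrict_apply measurableSet_Ioo, inter_eq_left.2 (Ioo_subset_Ioo ha hb),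
    Real.volume_Ioo, ENNReal.ofReal_eq_zero] at h1
  linarith

/-- Zero variance would make γ equal to its mean 1 almost everywhere. Monotonicity upgrades this to
every point, by squeezing between good points on either side. -/
theorem weightVar_pos {g : ℝ → ℝ} (hg : IsDistortion g) (hgconc : ConcaveOn ℝ (Icc 0 1) g)
    (hgac : AbsolutelyContinuousOnInterval g 0 1) (hγ : MemLp (weight g) 2 unif)
    (hγ1 : ∃ u ∈ Ioo (0 : ℝ) 1, weight g u ≠ 1) : 0 < weightVar g := by
  refine lt_of_le_of_ne (variance_nonneg _ _) fun h0 => ?_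
  obtain ⟨u, hu, hne⟩ := hγ1
  have hae := ae_eq_integral_of_variance_eq_zero hγ h0.symm
  rw [integral_weight_unif hg hgac] at hae
  obtain ⟨v, hv, hv1⟩ := exists_mem_Ioo_of_ae_unif hae le_rfl hu.1 hu.2.le
  obtain ⟨w, hw, hw1⟩ := exists_mem_Ioo_of_ae_unif hae hu.1.le hu.2 le_rfl
  have hmono := monotoneOn_weight hgconc
  have h1 := hmono ⟨hv.1, hv.2.trans hu.2⟩ hu hv.2.le
  have h2 := hmono hu ⟨hu.1.trans hw.1, hw.2⟩ hw.1.le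
  exact hne (le_antisymm (hw1 ▸ h2) (hv1 ▸ h1))

/-! ## The worst-case risk -/

theorem covariance_quantile_weight {g : ℝ → ℝ} {F : Measure ℝ} [IsProbabilityMeasure F]
    (hF1 : variance (fun z : ℝ => z) F = 1) (hV : 0 < weightVar g) :
    covariance (quantile F) (weight g) unif = √(weightVar g) * c0 g F := by
  have := (Real.sqrt_pos.2 hV).ne'
  rw [c0, corr, variance_quantile, hF1, Real.sqrt_one, one_mul]
  change _ = √(weightVar g) * (_ / √(weightVar g))
  field_simp

theorem c0_nonneg {g : ℝ → ℝ} {F : Measure ℝ} [IsProbabilityMeasure F]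
    (hF2 : MemLp (fun z : ℝ => z) 2 F) (hgconc : ConcaveOn ℝ (Icc 0 1) g)
    (hγ : MemLp (weight g) 2 unif) : 0 ≤ c0 g F :=
  div_nonneg (covariance_nonneg_of_monotoneOn (monotoneOn_quantile F) (monotoneOn_weight hgconc)
    (memLp_quantile hF2) hγ) (by positivity)

theorem c0_le_one {g : ℝ → ℝ} {F : Measure ℝ} [IsProbabilityMeasure F]
    (hF2 : MemLp (fun z : ℝ => z) 2 F) (hγ : MemLp (weight g) 2 unif) : c0 g F ≤ 1 := by
  refine div_le_one_of_le₀ ?_ (by positivity)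
  rw [← Real.sqrt_mul (variance_nonneg _ _)]
  exact Real.le_sqrt_of_sq_le (sq_covariance_le (memLp_quantile hF2) hγ)

theorem integral_weight_mul {g : ℝ → ℝ} (hg : IsDistortion g)
    (hgac : AbsolutelyContinuousOnInterval g 0 1) (hγ : MemLp (weight g) 2 unif) {Q : ℝ → ℝ}
    (hQ : MemLp Q 2 unif) :
    ∫ u, weight g u * Q u ∂unif = ∫ u, Q u ∂unif + covariance Q (weight g) unif := by
  rw [covariance_comm, covariance_eq_sub hγ hQ, integral_weight_unif hg hgac]
  simp

theorem map_affine_quantile (F : Measure ℝ) [IsProbabilityMeasure F] (a b : ℝ) :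
    unif.map (fun u => a + b * quantile F u) = locScale F a b := by
  conv_rhs => rw [locScale, ← map_quantile_unif F]
  rw [AEMeasurable.map_map_of_aemeasurable (by fun_prop)
    (aemeasurable_unif_of_monotoneOn (monotoneOn_quantile F))]
  rfl

/-- The Wasserstein distance between a member of the location-scale family of `F` and a law with
the same mean and variance. -/
theorem wasserstein_locScale_map_unif {F : Measure ℝ} [IsProbabilityMeasure F]
    (hF2 : MemLp (fun z : ℝ => z) 2 F) (hF0 : ∫ z, z ∂F = 0)
    (hF1 : variance (fun z : ℝ => z) F = 1) {μ σ : ℝ} (hσ : 0 ≤ σ) {Q : ℝ → ℝ}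
    (hQ : MonotoneOn Q (Ioo 0 1)) (hQ2 : MemLp Q 2 unif) (hQμ : ∫ u, Q u ∂unif = μ)
    (hQσ : variance Q unif = σ ^ 2) :
    wasserstein (locScale F μ σ) (unif.map Q)
      = ENNReal.ofReal (2 * σ ^ 2 - 2 * σ * covariance (quantile F) Q unif) ^ (1 / 2 : ℝ) := by
  have hq := memLp_quantile hF2
  have hq' : MemLp (fun u => σ * quantile F u) 2 unif := hq.const_mul σ
  have hmono : MonotoneOn (fun u => μ + σ * quantile F u) (Ioo 0 1) := fun u hu v hv huv => by
    have := mul_le_mul_of_nonneg_left (monotoneOn_quantile F hu hv huv) hσ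
    simpa using this
  have hqi : Integrable (fun u => σ * quantile F u) unif := hq'.integrable (by norm_num)
  have hB : MemLp (fun u => μ + σ * quantile F u) 2 unif := (memLp_const μ).add hq'
  rw [← map_affine_quantile, wasserstein_map_unif hmono hQ, lintegral_sq_sub_eq_ofReal hB hQ2,
    variance_const_add hq'.aestronglyMeasurable, variance_const_mul, variance_quantile, hF1,
    covariance_const_add_left hqi, covariance_const_mul_left, hQμ, hQσ,
    integral_add (integrable_const _) hqi, integral_const_mul, integral_quantile, hF0]
  congr 2
  simp
  ring

theorem ofReal_effTol (g : ℝ → ℝ) (F : Measure ℝ) (S : Matrix (Fin n) (Fin n) ℝ) (ε : ℝ≥0∞)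
    (x : Fin n → ℝ) : ENNReal.ofReal (effTol g F S ε x)
      = min ε (ENNReal.ofReal (2 * portStd S x ^ 2 * (1 - c0 g F))) :=
  ENNReal.ofReal_toReal (ne_top_of_le_ne_top ENNReal.ofReal_ne_top (min_le_right _ _))

/-- The objective in terms of the correlation `r` with the benchmark that the effective tolerance
allows. -/
theorem objective_eq {g : ℝ → ℝ} {F : Measure ℝ} {m x : Fin n → ℝ} {S : Matrix (Fin n) (Fin n) ℝ}
    {ε : ℝ≥0∞} (hσ : 0 < portStd S x) {r : ℝ}
    (hr : effTol g F S ε x = 2 * portStd S x ^ 2 * (1 - r)) :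
    objective g F m S ε x = -portMean m x + portStd S x * √(weightVar g)
      * (r * c0 g F + √(1 - r ^ 2) * √(1 - c0 g F ^ 2)) := by
  rw [objective, hr]
  set σ := portStd S x
  have h1 : 2 * σ ^ 2 * (1 - r) - (2 * σ ^ 2 * (1 - r)) ^ 2 / (4 * σ ^ 2)
      = σ ^ 2 * (1 - r ^ 2) := by
    field_simp
    ring
  have h2 : σ - 2 * σ ^ 2 * (1 - r) / (2 * σ) = σ * r := by
    field_simp
    ring
  rw [h1, h2, Real.sqrt_mul (sq_nonneg σ), Real.sqrt_sq hσ.le,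
    Real.sqrt_mul (show 0 ≤ weightVar g from variance_nonneg _ _)]
  ring

/-! ### Upper bound for the risk over the Wasserstein ball. -/

theorem covariance_le_of_covariance_ge {Ω : Type*} [MeasurableSpace Ω] {P : Measure Ω}
    [IsProbabilityMeasure P] {X Y Z : Ω → ℝ} (hX : MemLp X 2 P) (hY : MemLp Y 2 P)
    (hZ : MemLp Z 2 P) {σ τ c r : ℝ} (hσ : 0 < σ) (hτ : 0 < τ) (hX1 : variance X P = σ ^ 2)
    (hY1 : variance Y P = 1) (hZ1 : variance Z P = τ ^ 2) (hc : covariance Y Z P = τ * c)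
    (hc0 : -1 ≤ c) (hcr : c ≤ r) (hr1 : r ≤ 1) (hr : σ * r ≤ covariance Y X P ∨ r = c) :
    covariance X Z P ≤ σ * τ * (r * c + √(1 - r ^ 2) * √(1 - c ^ 2)) := by
  have hX' : MemLp (fun ω => σ⁻¹ * X ω) 2 P := hX.const_mul _
  have hZ' : MemLp (fun ω => τ⁻¹ * Z ω) 2 P := hZ.const_mul _
  have vX : variance (fun ω => σ⁻¹ * X ω) P = 1 := by
    rw [variance_const_mul, hX1]
    field_simp
  have vZ : variance (fun ω => τ⁻¹ * Z ω) P = 1 := by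
    rw [variance_const_mul, hZ1]
    field_simp
  have cYZ : covariance Y (fun ω => τ⁻¹ * Z ω) P = c := by
    rw [covariance_const_mul_right, hc]
    field_simp
  set a := covariance (fun ω => σ⁻¹ * X ω) Y P with ha
  set p := covariance (fun ω => σ⁻¹ * X ω) (fun ω => τ⁻¹ * Z ω) P with hp
  have hXZ : covariance X Z P = σ * τ * p := by
    rw [hp, covariance_const_mul_left, covariance_const_mul_right]
    field_simp
  have hYX : covariance Y X P = σ * a := by
    rw [ha, covariance_const_mul_left, covariance_comm X]
    field_simp
  have ha1 : a ≤ 1 := by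
    have := sq_covariance_le hX' hY
    rw [vX, hY1, ← ha] at this
    nlinarith
  have hp1 : p ≤ 1 := by
    have := sq_covariance_le hX' hZ'
    rw [vX, vZ, ← hp] at this
    nlinarith
  rw [hXZ]
  refine mul_le_mul_of_nonneg_left ?_ (by positivity)
  rcases hr with hr | rfl
  · have h := sq_covariance_sub_mul_le hX' hY hZ' vX hY1 vZ
    rw [cYZ] at h
    rw [hYX] at hr
    exact le_of_sq_sub_mul_le hc0 hcr (le_of_mul_le_mul_left hr hσ) ha1 h
  -- For r = c the bracket is c² + (1 - c²) = 1, so plain Cauchy–Schwarz suffices.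
  · rw [Real.mul_self_sqrt (by nlinarith)]
    linarith

/-- The correlation `r` with the benchmark that the tolerance `ε` effectively allows. -/
theorem exists_effTol_eq {x : Fin n → ℝ} {S : Matrix (Fin n) (Fin n) ℝ}
    (hσ : 0 < portStd S x) (ε : ℝ≥0∞) {F : Measure ℝ} {g : ℝ → ℝ} (hc1 : c0 g F ≤ 1) :
    ∃ r, effTol g F S ε x = 2 * portStd S x ^ 2 * (1 - r) ∧ c0 g F ≤ r ∧ r ≤ 1 ∧
      ENNReal.ofReal (2 * portStd S x ^ 2 * (1 - r)) ≤ ε ∧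
      ∀ t, ENNReal.ofReal (2 * portStd S x ^ 2 - 2 * portStd S x * t) ≤ ε →
        portStd S x * r ≤ t ∨ r = c0 g F := by
  set σ := portStd S x with hσdef
  obtain ⟨r, hr⟩ : ∃ r, effTol g F S ε x = 2 * σ ^ 2 * (1 - r) :=
    ⟨1 - effTol g F S ε x / (2 * σ ^ 2), by field_simp; ring⟩
  have hT := ofReal_effTol g F S ε x
  have hT0 : 0 ≤ effTol g F S ε x := ENNReal.toReal_nonneg
  have hnn : 0 ≤ 2 * σ ^ 2 * (1 - c0 g F) := mul_nonneg (by positivity) (by linarith)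
  have hσσ : 0 < 2 * σ ^ 2 := by positivity
  refine ⟨r, hr, ?_, ?_, ?_, fun t ht => ?_⟩
  · have h := hT.trans_le (min_le_right _ _)
    rw [ENNReal.ofReal_le_ofReal_iff hnn, hr] at h
    linarith [le_of_mul_le_mul_left h hσσ]
  · rw [hr] at hT0
    linarith [nonneg_of_mul_nonneg_right hT0 hσσ]
  · rw [← hr]
    exact hT.trans_le (min_le_left _ _)
  -- Either ε is the minimum, and the tolerance condition on t reads σr ≤ t, or the cap is, and r =
  -- c₀.
  · rcases le_total ε (ENNReal.ofReal (2 * portStd S x ^ 2 * (1 - c0 g F))) with h | h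
    · rw [min_eq_left h] at hT
      rw [← hT, ENNReal.ofReal_le_ofReal_iff hT0, hr] at ht
      left
      have : σ * (σ * r) ≤ σ * t := by linarith
      exact le_of_mul_le_mul_left this hσ
    · right
      rw [min_eq_right h, ENNReal.ofReal_eq_ofReal_iff hT0 hnn, hr] at hT
      linarith [mul_left_cancel₀ hσσ.ne' hT]

theorem distortionRisk_lossLaw_le {m x : Fin n → ℝ} {S : Matrix (Fin n) (Fin n) ℝ}
    (hσ : 0 < portStd S x) {ε : ℝ≥0∞} {F : Measure ℝ} [IsProbabilityMeasure F]
    (hF2 : MemLp (fun z : ℝ => z) 2 F) (hF0 : ∫ z, z ∂F = 0)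
    (hF1 : variance (fun z : ℝ => z) F = 1) {g : ℝ → ℝ} (hg : IsDistortion g)
    (hgconc : ConcaveOn ℝ (Icc 0 1) g) (hgac : AbsolutelyContinuousOnInterval g 0 1)
    (hγ : MemLp (weight g) 2 unif) (hV : 0 < weightVar g) {R : Measure (Fin n → ℝ)}
    (hR : HasMoments R m S)
    (hd : wasserstein (benchmark F m S x) (lossLaw R x) ≤ ε ^ (1 / 2 : ℝ)) :
    distortionRisk g (lossLaw R x) ≤ (objective g F m S ε x : EReal) := by
  obtain ⟨hP, hG2, hGm, hGv⟩ := hR.lossLaw_moments x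
  set G := lossLaw R x
  have hσ2 : x ⬝ᵥ (S *ᵥ x) = portStd S x ^ 2 := (Real.sq_sqrt (Real.sqrt_pos.1 hσ).le).symm
  set σ := portStd S x with hσdef
  have hQ := monotoneOn_quantile G
  have hQ2 := memLp_quantile hG2
  have hQm : ∫ u, quantile G u ∂unif = -portMean m x := by rw [integral_quantile, hGm]
  have hQv : variance (quantile G) unif = σ ^ 2 := by rw [variance_quantile, hGv, hσ2]
  have hc0 := c0_nonneg (F := F) hF2 hgconc hγ
  obtain ⟨r, hr, hcr, hr1, -, htol⟩ := exists_effTol_eq hσ ε (c0_le_one (F := F) hF2 hγ)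
  rw [← map_quantile_unif G] at hd ⊢
  rw [distortionRisk_map_unif hg hgac hγ hQ hQ2, EReal.coe_le_coe_iff,
    integral_weight_mul hg hgac hγ hQ2, hQm, objective_eq hσ hr]
  refine add_le_add le_rfl ?_
  refine covariance_le_of_covariance_ge hQ2 (memLp_quantile hF2) hγ hσ (Real.sqrt_pos.2 hV) hQv
    ((variance_quantile F).trans hF1) (Real.sq_sqrt hV.le).symm
    (covariance_quantile_weight hF1 hV) (by linarith) hcr hr1 ?_
  rw [benchmark, wasserstein_locScale_map_unif hF2 hF0 hF1 hσ.le hQ hQ2 hQm hQv,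
    ENNReal.rpow_le_rpow_iff (by norm_num)] at hd
  exact htol _ hd

/-! ### Attainment of the upper bound. -/

/-- For unit vectors Y and Z with inner product c, the vector bY + dZ is to have norm 1, inner
product r with Y and the extremal one with Z. This forces d = √(1 - r²)/√(1 - c²) when c < 1. From c
≤ r follows d ≤ 1, hence b = r - dc ≥ 0; the signs keep the combination monotone. -/
theorem exists_coefficients {c r : ℝ} (hc : 0 ≤ c) (hcr : c ≤ r) (hr : r ≤ 1) :
    ∃ b d : ℝ, 0 ≤ b ∧ 0 ≤ d ∧ b + d * c = r ∧
      b * c + d = r * c + √(1 - r ^ 2) * √(1 - c ^ 2) ∧ b ^ 2 + 2 * b * d * c + d ^ 2 = 1 := by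
  rcases eq_or_lt_of_le (hcr.trans hr) with h1 | h1
  -- For c = 1 the two directions coincide and the formula for d degenerates; then r = 1 and Y
  -- itself serves.
  · subst h1
    obtain rfl := le_antisymm hr hcr
    exact ⟨1, 0, by norm_num, le_rfl, by ring, by norm_num, by ring⟩
  · have hC : 0 < 1 - c ^ 2 := by nlinarith
    have hR : 0 ≤ 1 - r ^ 2 := by nlinarith
    have hy : 0 < √(1 - c ^ 2) := Real.sqrt_pos.2 hC
    have hz : 0 ≤ √(1 - r ^ 2) := Real.sqrt_nonneg _
    have hy2 : √(1 - c ^ 2) ^ 2 = 1 - c ^ 2 := Real.sq_sqrt hC.le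
    have hz2 : √(1 - r ^ 2) ^ 2 = 1 - r ^ 2 := Real.sq_sqrt hR
    have hzy : √(1 - r ^ 2) ≤ √(1 - c ^ 2) := Real.sqrt_le_sqrt (by nlinarith)
    obtain ⟨d, hd⟩ : ∃ d, d = √(1 - r ^ 2) / √(1 - c ^ 2) := ⟨_, rfl⟩
    have hdy : d * √(1 - c ^ 2) = √(1 - r ^ 2) := by rw [hd]; field_simp
    have hd0 : 0 ≤ d := hd ▸ div_nonneg hz hy.le
    have hd1 : d ≤ 1 := hd ▸ div_le_one_of_le₀ hzy hy.le
    have hd2 : d ^ 2 * (1 - c ^ 2) = 1 - r ^ 2 := by rw [← hy2, ← mul_pow, hdy, hz2]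
    have hdC : √(1 - r ^ 2) * √(1 - c ^ 2) = d * (1 - c ^ 2) := by rw [← hdy, mul_assoc, ← sq, hy2]
    refine ⟨r - d * c, d, by nlinarith, hd0, by ring, ?_, by linear_combination hd2⟩
    rw [hdC]
    ring

/-- A non-decreasing combination of two non-decreasing functions with prescribed mean and variance,
prescribed correlation `r` with the first and the largest possible covariance with the second. -/
theorem exists_monotoneOn_covariance_eq {Q₁ Q₂ : ℝ → ℝ} (h₁ : MonotoneOn Q₁ (Ioo 0 1))
    (h₂ : MonotoneOn Q₂ (Ioo 0 1)) (hQ₁ : MemLp Q₁ 2 unif) (hQ₂ : MemLp Q₂ 2 unif) {τ c r : ℝ}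
    (hτ : 0 < τ) (hv₁ : variance Q₁ unif = 1) (hv₂ : variance Q₂ unif = τ ^ 2)
    (hcov : covariance Q₁ Q₂ unif = τ * c) (hc : 0 ≤ c) (hcr : c ≤ r) (hr : r ≤ 1) (μ : ℝ)
    {σ : ℝ} (hσ : 0 < σ) :
    ∃ Q : ℝ → ℝ, MonotoneOn Q (Ioo 0 1) ∧ MemLp Q 2 unif ∧ ∫ u, Q u ∂unif = μ ∧
      variance Q unif = σ ^ 2 ∧ covariance Q₁ Q unif = σ * r ∧
      covariance Q Q₂ unif = σ * τ * (r * c + √(1 - r ^ 2) * √(1 - c ^ 2)) := by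
  obtain ⟨b, d, hb, hd, hbd1, hbd2, hbd3⟩ := exists_coefficients hc hcr hr
  have hbf : MemLp (fun u => σ * b * Q₁ u) 2 unif := hQ₁.const_mul _
  have hdw : MemLp (fun u => σ * d / τ * Q₂ u) 2 unif := hQ₂.const_mul _
  obtain ⟨K, hK⟩ : ∃ K : ℝ → ℝ, K = fun u => σ * b * Q₁ u + σ * d / τ * Q₂ u := ⟨_, rfl⟩
  have hK2 : MemLp K 2 unif := hK ▸ hbf.add hdw
  have hKi : Integrable K unif := hK2.integrable (by norm_num)
  have hKm : MonotoneOn K (Ioo 0 1) := hK ▸ fun u hu v hv huv =>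
    add_le_add (mul_le_mul_of_nonneg_left (h₁ hu hv huv) (by positivity))
      (mul_le_mul_of_nonneg_left (h₂ hu hv huv) (by positivity))
  have hcK : ∀ U, MemLp U 2 unif →
      covariance K U unif = σ * b * covariance Q₁ U unif + σ * d / τ * covariance Q₂ U unif := by
    intro U hU
    have : covariance K U unif = covariance (fun u => σ * b * Q₁ u) U unif
        + covariance (fun u => σ * d / τ * Q₂ u) U unif := hK ▸ covariance_add_left hbf hdw hU
    rw [this, covariance_const_mul_left, covariance_const_mul_left]
  have hK₁ : covariance K Q₁ unif = σ * r := by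
    rw [hcK _ hQ₁, covariance_comm Q₂, hcov, covariance_self hQ₁.aestronglyMeasurable.aemeasurable,
      hv₁, ← hbd1]
    field_simp
  have hK₂ : covariance K Q₂ unif = σ * τ * (r * c + √(1 - r ^ 2) * √(1 - c ^ 2)) := by
    rw [hcK _ hQ₂, hcov, covariance_self hQ₂.aestronglyMeasurable.aemeasurable, hv₂, ← hbd2]
    field_simp
  have hKv : variance K unif = σ ^ 2 := by
    rw [← covariance_self hK2.aestronglyMeasurable.aemeasurable, hcK K hK2, covariance_comm Q₁,
      covariance_comm Q₂, hK₁, hK₂, ← hbd2, ← hbd1]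
    field_simp
    linear_combination hbd3
  obtain ⟨k, hk⟩ : ∃ k, k = μ - ∫ v, K v ∂unif := ⟨_, rfl⟩
  have hQ2 : MemLp (fun u => k + K u) 2 unif := MemLp.add (memLp_const k) hK2
  refine ⟨fun u => k + K u, fun u hu v hv huv => add_le_add le_rfl (hKm hu hv huv), hQ2,
    ?_, ?_, ?_, ?_⟩
  · rw [integral_add (integrable_const _) hKi, hk]
    simp
  · rw [variance_const_add hK2.aestronglyMeasurable, hKv]
  · rw [covariance_const_add_right hKi, covariance_comm, hK₁]
  · rw [covariance_const_add_left hKi, hK₂]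

/-- The extremal law lies at squared distance exactly the effective tolerance 2σ²(1 - r), which is
at most ε. -/
theorem objective_mem_riskValues {m x : Fin n → ℝ} {S : Matrix (Fin n) (Fin n) ℝ}
    (hS : S.PosSemidef) (hσ : 0 < portStd S x) {ε : ℝ≥0∞} {F : Measure ℝ}
    [IsProbabilityMeasure F]
    (hF2 : MemLp (fun z : ℝ => z) 2 F) (hF0 : ∫ z, z ∂F = 0)
    (hF1 : variance (fun z : ℝ => z) F = 1) {g : ℝ → ℝ} (hg : IsDistortion g)
    (hgconc : ConcaveOn ℝ (Icc 0 1) g) (hgac : AbsolutelyContinuousOnInterval g 0 1)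
    (hγ : MemLp (weight g) 2 unif) (hV : 0 < weightVar g) :
    (objective g F m S ε x : EReal) ∈ riskValues g F m S ε x := by
  have hσ2 : x ⬝ᵥ (S *ᵥ x) = portStd S x ^ 2 := (Real.sq_sqrt (Real.sqrt_pos.1 hσ).le).symm
  obtain ⟨r, hr, hcr, hr1, htol, -⟩ := exists_effTol_eq hσ ε (c0_le_one (F := F) hF2 hγ)
  obtain ⟨Q, hQ, hQ2, hQμ, hQσ, hfQ, hQγ⟩ := exists_monotoneOn_covariance_eq
    (monotoneOn_quantile F) (monotoneOn_weight hgconc) (memLp_quantile hF2) hγ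
    (Real.sqrt_pos.2 hV) ((variance_quantile F).trans hF1) (Real.sq_sqrt hV.le).symm
    (covariance_quantile_weight hF1 hV) (c0_nonneg hF2 hgconc hγ) hcr hr1 (-portMean m x) hσ
  have hQm := aemeasurable_unif_of_monotoneOn hQ
  have := isProbabilityMeasure_map_unif hQ
  obtain ⟨R, hR, hRG⟩ := exists_hasMoments_lossLaw_eq (m := m) (x := x) hS
    (by rw [hσ2]; positivity) (unif.map Q)
    ((memLp_map_measure_iff aestronglyMeasurable_id hQm).2 hQ2)
    ((integral_map hQm aestronglyMeasurable_id).trans hQμ)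
    ((variance_map aemeasurable_id hQm).trans (hQσ.trans hσ2.symm))
  refine ⟨R, hR, ?_, ?_⟩
  · rw [hRG, benchmark, wasserstein_locScale_map_unif hF2 hF0 hF1 hσ.le hQ hQ2 hQμ hQσ,
      ENNReal.rpow_le_rpow_iff (by norm_num), hfQ]
    refine le_trans (le_of_eq ?_) htol
    congr 1
    ring
  · rw [hRG, distortionRisk_map_unif hg hgac hγ hQ hQ2, integral_weight_mul hg hgac hγ hQ2, hQμ,
      hQγ, objective_eq hσ hr]

end RobustPortfolio

theorem mainTheorem10
    {n : ℕ} (P : Set (Fin n → ℝ))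
    (m : Fin n → ℝ) (S : Matrix (Fin n) (Fin n) ℝ) (hS : S.PosSemidef)
    (hσ : ∀ x ∈ P, 0 < RobustPortfolio.portStd S x)
    (ε : (Fin n → ℝ) → ℝ≥0∞)
    (F : Measure ℝ) [IsProbabilityMeasure F] (hF2 : MemLp (fun z : ℝ => z) 2 F)
    (hF0 : ∫ z, z ∂F = 0) (hF1 : variance (fun z : ℝ => z) F = 1)
    (g : ℝ → ℝ) (hg : RobustPortfolio.IsDistortion g)
    (hgconc : ConcaveOn ℝ (Icc 0 1) g)
    (hgac : AbsolutelyContinuousOnInterval g 0 1)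
    (hγ2 : MemLp (RobustPortfolio.weight g) 2 RobustPortfolio.unif)
    (hγ1 : ∃ u ∈ Ioo (0 : ℝ) 1, RobustPortfolio.weight g u ≠ 1) :
    (∀ x ∈ P, IsGreatest (RobustPortfolio.riskValues g F m S (ε x) x)
      (RobustPortfolio.objective g F m S (ε x) x : EReal)) ∧
    (⨅ x ∈ P, RobustPortfolio.worstCaseRisk g F m S (ε x) x)
      = (⨅ x ∈ P, (RobustPortfolio.objective g F m S (ε x) x : EReal)) ∧
    (∀ x ∈ P,
      IsMinOn (fun y => RobustPortfolio.worstCaseRisk g F m S (ε y) y) P x ↔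
      IsMinOn (fun y => RobustPortfolio.objective g F m S (ε y) y) P x) := by
  have hV := RobustPortfolio.weightVar_pos hg hgconc hgac hγ2 hγ1
  have hmax : ∀ x ∈ P, IsGreatest (RobustPortfolio.riskValues g F m S (ε x) x)
      (RobustPortfolio.objective g F m S (ε x) x : EReal) := by
    refine fun x hx => ⟨RobustPortfolio.objective_mem_riskValues hS (hσ x hx) hF2 hF0 hF1
      hg hgconc hgac hγ2 hV, ?_⟩
    rintro _ ⟨R, hR, hd, rfl⟩
    exact RobustPortfolio.distortionRisk_lossLaw_le (hσ x hx) hF2 hF0 hF1 hg hgconc hgac hγ2 hV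
      hR hd
  have hworst : ∀ x ∈ P, RobustPortfolio.worstCaseRisk g F m S (ε x) x
      = (RobustPortfolio.objective g F m S (ε x) x : EReal) := fun x hx => (hmax x hx).csSup_eq
  -- The infima live in `EReal`, so an empty P or an objective unbounded below needs no separate
  -- treatment.
  refine ⟨hmax, iInf_congr fun x => iInf_congr fun hx => hworst x hx, fun x hx => ?_⟩
  simp only [isMinOn_iff]
  refine forall₂_congr fun y hy => ?_
  rw [hworst x hx, hworst y hy, EReal.coe_le_coe_iff]
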